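/- Let $d\in\mathbb N$, let $\mathcal X_1,\dots,\mathcal X_d$ be Polish spaces with their Borel $\sigma$-algebras, let $B_1,\dots,B_d$ be separable real Banach spaces, and let $\varphi_j:\mathcal X_j\to B_j$ be continuous, bounded and injective for $j=1,\dots,d$. For $\mathbf i=(i_1,\dots,i_d)\in\mathbb N^d$ (with $0\in\mathbb N$) put $m=\deg(\mathbf i)=i_1+\dots+i_d$, and let $B^{\otimes\mathbf i}=B_1^{\otimes i_1}\otimes\cdots\otimes B_d^{\otimes i_d}$ be the completed projective tensor product. For a Borel probability measure $\gamma$ on $\mathcal X_1\times\dots\times\mathcal X_d$ and $(X_1,\dots,X_d)\sim\gamma$ let $$\gamma^{\mathbf i}=\operatorname{Law}(\underbrace{X_1,\dots,X_1}_{i_1},\dots,\underbrace{X_d,\dots,X_d}_{i_d}),$$ a probability measure with $m$ coordinates. For a partition $\pi$ of $\{1,\dots,m\}$ with $|\pi|$ blocks let $\gamma^{\mathbf i}_\pi$ be the product, over the blocks of $\pi$, of the marginals of $\gamma^{\mathbf i}$ on these blocks, regarded as a measure on the same $m$ coordinates. The cumulants of $\gamma$ are the Bochner integrals $$\kappa^{\mathbf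 i}(\gamma)=\sum_{\pi}(-1)^{|\pi|-1}(|\pi|-1)!\int \varphi_1(y_1)\otimes\cdots\otimes\varphi_1(y_{i_1})\otimes\cdots\otimes\varphi_d(y_{m-i_d+1})\otimes\cdots\otimes\varphi_d(y_m)\;d\gamma^{\mathbf i}_\pi(y_1,\dots,y_m)\in B^{\otimes\mathbf i},$$ the sum being over all partitions $\pi$ of $\{1,\dots,m\}$ (for $\mathbf i=0$, $\kappa^{0}(\gamma)$ is a constant that does not depend on $\gamma$), and $\kappa(\gamma)=(\kappa^{\mathbf i}(\gamma))_{\mathbf i\in\mathbb N^d}$. The cumulant $\kappa^{\mathbf i}(\gamma)$ is called a cross cumulant if at least two of the entries $i_1,\dots,i_d$ are positive (for $d=2$ this means $\mathbf i\in\mathbb N_+^2$). Theorem. Let $\gamma$ and $\eta$ be Borel probability measures on $\mathcal X_1\times\dots\times\mathcal X_d$. Then 1. $\gamma=\eta$ if and only if $\kappa(\gamma)=\kappa(\eta)$. 2. $\gamma=\bigotimes_{j=1}^d\gamma|_{\mathcal X_j}$ (the product of its marginals) if and only if all cross cumulants of $\gamma$ vanish, that is, $\kappa^{\mathbf i}(\gamma)=0$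 for all $\mathbf i\in\mathbb N^d$ with at least two positive entries. -/

import Mathlib

open MeasureTheory
open scoped TensorProduct

noncomputable section

namespace TensorCumulant

universe u v

/-- The `deg i = i 0 + ⋯ + i (d-1)` coordinate slots belonging to a multi-index `i`: the slot
`⟨j, r⟩` is the `r`-th copy of the coordinate `j`. -/
abbrev Slot {d : ℕ} (i : Fin d → ℕ) : Type := Σ j : Fin d, Fin (i j)

/-- The diagonal measure `γ^i`: the law of the vector in which every coordinate `X j` of
`(X j)_j ∼ γ` is repeated `i j` times. -/
def diagonalMeasure {d : ℕ} {X : Fin d → Type u} [∀ j, MeasurableSpace (X j)]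
    (γ : Measure (∀ j, X j)) (i : Fin d → ℕ) : Measure (∀ s : Slot i, X s.1) :=
  γ.map (fun x s => x s.1)

/-- The partition measure `μ_π`: the product over the blocks of `π` of the marginals of `μ` on
these blocks (with the coordinates put back in their original places). -/
def partitionMeasure {ι : Type} [Fintype ι] [DecidableEq ι] {Y : ι → Type u}
    [∀ a, MeasurableSpace (Y a)] (μ : Measure (∀ a, Y a))
    (π : Finpartition (Finset.univ : Finset ι)) : Measure (∀ a, Y a) :=
  (Measure.pi (fun b : π.parts => μ.map (Finset.restrict (π := Y) b.1))).map
    (fun z a => z ⟨π.part a, π.part_mem.2 (Finset.mem_univ a)⟩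
      ⟨a, π.mem_part (Finset.mem_univ a)⟩)

/-- The Banach space `B^{⊗ i} = B_1^{⊗ i_1} ⊗ ⋯ ⊗ B_d^{⊗ i_d}`: the completion of the algebraic
tensor product (over all slots of `i`) for the projective tensor norm. -/
abbrev TensorPower {d : ℕ} (B : Fin d → Type v) [∀ j, NormedAddCommGroup (B j)]
    [∀ j, NormedSpace ℝ (B j)] (i : Fin d → ℕ) : Type v :=
  UniformSpace.Completion (⨂[ℝ] s : Slot i, B s.1)

/-- The map `φ^{⊗ i}` on slot vectors: `(y_s)_s ↦ ⨂_s φ (y_s)`. -/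
def featureTensor {d : ℕ} {X : Fin d → Type u} {B : Fin d → Type v}
    [∀ j, NormedAddCommGroup (B j)] [∀ j, NormedSpace ℝ (B j)]
    (φ : ∀ j, X j → B j) (i : Fin d → ℕ) (y : ∀ s : Slot i, X s.1) : TensorPower B i :=
  ((⨂ₜ[ℝ] s : Slot i, φ s.1 (y s) : ⨂[ℝ] s : Slot i, B s.1) : TensorPower B i)

/-- The cumulant `κ^i(γ) = ∑_π c_π E_{(γ^i)_π} [φ^{⊗ i}]`, where `π` runs over all partitions of
the `deg i` slots and `c_π = (-1)^(|π|-1) (|π|-1)!`. (For `i = 0` the only partition is the empty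
one, and the value is the constant `1`, whatever the measure.) -/
def cumulant {d : ℕ} {X : Fin d → Type u} [∀ j, MeasurableSpace (X j)] {B : Fin d → Type v}
    [∀ j, NormedAddCommGroup (B j)] [∀ j, NormedSpace ℝ (B j)]
    (φ : ∀ j, X j → B j) (γ : Measure (∀ j, X j)) (i : Fin d → ℕ) : TensorPower B i :=
  ∑ π : Finpartition (Finset.univ : Finset (Slot i)),
    ((-1 : ℝ) ^ (π.parts.card - 1) * ((π.parts.card - 1).factorial : ℝ)) •
      ∫ y, featureTensor φ i y ∂(partitionMeasure (diagonalMeasure γ i) π)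

/-- The family `κ(γ) = (κ^i(γ))_i`, indexed by all multi-indices. -/
def cumulants {d : ℕ} {X : Fin d → Type u} [∀ j, MeasurableSpace (X j)] {B : Fin d → Type v}
    [∀ j, NormedAddCommGroup (B j)] [∀ j, NormedSpace ℝ (B j)]
    (φ : ∀ j, X j → B j) (γ : Measure (∀ j, X j)) : ∀ i : Fin d → ℕ, TensorPower B i :=
  fun i => cumulant φ γ i

/-- The multi-indices of the cross cumulants: those that involve at least two different
coordinates. -/
def IsCross {d : ℕ} (i : Fin d → ℕ) : Prop :=
  ∃ j k : Fin d, j ≠ k ∧ 0 < i j ∧ 0 < i k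

end TensorCumulant

end

/-! Pairing `κ^i` with a functional `⨂ f_s` gives the scalar cumulant: a sum over partitions of
products of moments `∫ ∏ f_s (φ (x_s)) dγ`, one per block. The one-block partition has coefficient
1, and all other partitions involve only moments of lower degree. By induction on the degree, the
cumulants determine all moments (`moments_eq_of_cumulants_eq`). The monomials span an algebra of
bounded continuous functions that separates points, so on a Polish space their integrals determine
the measure (`eq_of_moments_eq`).

For a product measure and a cross index, let `A` be the set of slots of one coordinate. By
independence a partition measure depends only on the traces of `π` on `A` and `Aᶜ`, and the
coefficients `c_π` over each class of equal traces sum to 0 (`sum_cumulantCoeff_sameTraces`). Indeed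
`c_π` is the linear coefficient of the falling factorial `(t)_|π|`, which counts colourings with
level partition `π`. Summed over a class this counts colourings with prescribed traces, that is
`(t)_k (t)_l` with `k, l ≥ 1`, a multiple of `t²`.

Conversely, if the cross cumulants of `γ` vanish, then `γ` and the product of its marginals have the
same cumulants, because the remaining ones see only marginals; the first part applies. -/

namespace TensorCumulant

universe u v

/-! ### Cancellation of cumulant coefficients by counting colourings -/

section Combinatorics

/-- Removing the factor `X` and evaluating at 0 leaves the previous falling factorial at `-1`. The
case `n = 0` fails: truncated subtraction makes the right side 1. -/
theorem coeff_one_descPochhammer (n : ℕ) (hn : n ≠ 0) :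
    (descPochhammer ℝ n).coeff 1 = (-1) ^ (n - 1) * ((n - 1).factorial : ℝ) := by
  obtain ⟨n, rfl⟩ := Nat.exists_eq_succ_of_ne_zero hn
  have key : ∀ n : ℕ, (descPochhammer ℝ n).eval (-1) = (-1) ^ n * (n.factorial : ℝ) := by
    intro n
    induction n with
    | zero => simp
    | succ n ih =>
      rw [descPochhammer_succ_eval, ih, Nat.factorial_succ]
      push_cast
      ring
  rw [Nat.succ_eq_add_one, descPochhammer_succ_left, Polynomial.coeff_X_mul,
    Polynomial.coeff_zero_eq_eval_zero, Polynomial.eval_comp]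
  simp [key]

/-- The colourings of `α` whose level sets are the classes of a setoid `r` are the injective
colourings of the quotient. -/
def colouringEquiv {α : Type*} (r : Setoid α) (t : ℕ) :
    {h : α → Fin t // ∀ x y, h x = h y ↔ r x y} ≃ (Quotient r ↪ Fin t) where
  toFun h := ⟨Quotient.lift h.1 fun x y hxy => (h.2 x y).2 hxy, by
    rintro ⟨x⟩ ⟨y⟩ hxy
    exact Quotient.sound ((h.2 x y).1 hxy)⟩
  invFun e := ⟨fun x => e ⟦x⟧, fun x y => by
    rw [e.injective.eq_iff]
    exact Quotient.eq⟩
  left_inv h := rfl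
  right_inv e := by
    ext ⟨x⟩
    rfl

theorem card_colouring {α : Type*} [Finite α] (r : Setoid α) (t : ℕ) :
    Nat.card {h : α → Fin t // ∀ x y, h x = h y ↔ r x y} =
      t.descFactorial (Nat.card (Quotient r)) := by
  classical
  have := Fintype.ofFinite α
  have := Fintype.ofFinite (Quotient r)
  rw [Nat.card_congr (colouringEquiv r t), Nat.card_eq_fintype_card, Fintype.card_embedding_eq,
    Nat.card_eq_fintype_card, Fintype.card_fin]

variable {ι : Type*} [Fintype ι] [DecidableEq ι]

theorem card_colouring_finpartition (π : Finpartition (Finset.univ : Finset ι)) (t : ℕ) :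
    Nat.card {h : ι → Fin t // ∀ x y, h x = h y ↔ π.part x = π.part y} =
      t.descFactorial π.parts.card := by
  have h := card_colouring (Setoid.ker π.part) t
  simp only [Setoid.ker_def] at h
  rw [h, Nat.card_congr (Setoid.quotientKerEquivRange π.part)]
  congr 1
  have : Set.range π.part = (π.parts : Set (Finset ι)) := by
    ext b
    constructor
    · rintro ⟨x, rfl⟩
      exact π.part_mem.2 (Finset.mem_univ x)
    · intro hb
      obtain ⟨x, -, hx⟩ := π.part_surjOn hb
      exact ⟨x, hx⟩
  rw [this]
  simp

theorem finpartition_ext_part {π π' : Finpartition (Finset.univ : Finset ι)}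
    (h : ∀ x y, π.part x = π.part y ↔ π'.part x = π'.part y) : π = π' := by
  have hpart : ∀ x, π.part x = π'.part x := by
    intro x
    ext y
    rw [π.mem_part_iff_part_eq_part (Finset.mem_univ _) (Finset.mem_univ _), h,
      π'.mem_part_iff_part_eq_part (Finset.mem_univ _) (Finset.mem_univ _)]
  ext b
  constructor
  · intro hb
    obtain ⟨x, -, rfl⟩ := π.part_surjOn hb
    rw [hpart]
    exact π'.part_mem.2 (Finset.mem_univ x)
  · intro hb
    obtain ⟨x, -, rfl⟩ := π'.part_surjOn hb
    rw [← hpart]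
    exact π.part_mem.2 (Finset.mem_univ x)

open Classical in
/-- The partition into the level sets of a function. -/
noncomputable def kerPartition {β : Type*} (h : ι → β) :
    Finpartition (Finset.univ : Finset ι) :=
  Finpartition.ofSetoid (Setoid.ker h)

theorem kerPartition_part_eq_iff {β : Type*} (h : ι → β) (x y : ι) :
    (kerPartition h).part x = (kerPartition h).part y ↔ h x = h y := by
  classical
  rw [← Finpartition.mem_part_iff_part_eq_part _ (Finset.mem_univ _) (Finset.mem_univ _),
    kerPartition, Finpartition.mem_part_ofSetoid_iff_rel]
  exact eq_comm

/-- Two partitions have the same traces on `A` and on the complement of `A`. -/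
def sameTraces (A : Set ι) : Setoid (Finpartition (Finset.univ : Finset ι)) where
  r π π' := ∀ x y, (x ∈ A ↔ y ∈ A) → (π.part x = π.part y ↔ π'.part x = π'.part y)
  iseqv := ⟨fun _ _ _ _ => Iff.rfl, fun h x y hxy => (h x y hxy).symm,
    fun h h' x y hxy => (h x y hxy).trans (h' x y hxy)⟩

/-- The condition never compares a point of `A` with one outside, so the two restrictions of a
colouring are chosen independently. -/
theorem card_colouring_traces (A : Set ι) (τ : Finpartition (Finset.univ : Finset ι)) (t : ℕ) :
    Nat.card {h : ι → Fin t // ∀ x y, (x ∈ A ↔ y ∈ A) →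
        (h x = h y ↔ τ.part x = τ.part y)} =
      t.descFactorial (Nat.card (Quotient (Setoid.ker fun x : {x // x ∈ A} => τ.part x))) *
      t.descFactorial (Nat.card (Quotient (Setoid.ker fun x : {x // x ∉ A} => τ.part x))) := by
  classical
  rw [← card_colouring, ← card_colouring, ← Nat.card_prod]
  refine Nat.card_congr (Equiv.trans ?_ Equiv.subtypeProdEquivProd)
  refine (Equiv.piEquivPiSubtypeProd (fun x => x ∈ A) fun _ => Fin t).subtypeEquiv ?_
  intro h
  simp only [Setoid.ker_def, Equiv.piEquivPiSubtypeProd_apply, Subtype.forall]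
  constructor
  · intro H
    exact ⟨fun x hx y hy => H x y (by simp [hx, hy]), fun x hx y hy => H x y (by simp [hx, hy])⟩
  · rintro ⟨H, H'⟩ x y hxy
    by_cases hx : x ∈ A
    · exact H x hx y (hxy.1 hx)
    · exact H' x hx y (fun hy => hx (hxy.2 hy))

open Classical in
-- Double counting: the colourings with the traces of `τ` are sorted by their level partition.
theorem sum_descFactorial_sameTraces (A : Set ι) (τ : Finpartition (Finset.univ : Finset ι))
    (t : ℕ) :
    ∑ π with sameTraces A π τ, t.descFactorial π.parts.card =
      t.descFactorial (Nat.card (Quotient (Setoid.ker fun x : {x // x ∈ A} => τ.part x))) *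
      t.descFactorial (Nat.card (Quotient (Setoid.ker fun x : {x // x ∉ A} => τ.part x))) := by
  rw [← card_colouring_traces, Nat.card_eq_fintype_card, Fintype.card_subtype,
    Finset.card_eq_sum_card_fiberwise (f := kerPartition)
      (t := Finset.univ.filter fun π => sameTraces A π τ)]
  · refine Finset.sum_congr rfl fun π hπ => ?_
    rw [Finset.mem_filter] at hπ
    rw [← card_colouring_finpartition, Nat.card_eq_fintype_card, Fintype.card_subtype,
      Finset.filter_filter]
    congr 1
    ext h
    simp only [Finset.mem_filter, Finset.mem_univ, true_and]
    constructor
    · intro H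
      exact ⟨fun x y hxy => (H x y).trans (hπ.2 x y hxy), finpartition_ext_part fun x y => by
        rw [kerPartition_part_eq_iff, H]⟩
    · rintro ⟨-, rfl⟩ x y
      rw [kerPartition_part_eq_iff]
  · intro h hh
    simp only [Finset.coe_filter, Finset.mem_univ, true_and, Set.mem_ofPred_eq] at hh ⊢
    intro x y hxy
    rw [kerPartition_part_eq_iff, hh x y hxy]

/-- The coefficient `c_π` of a cumulant. -/
noncomputable def cumulantCoeff (π : Finpartition (Finset.univ : Finset ι)) : ℝ :=
  (-1 : ℝ) ^ (π.parts.card - 1) * ((π.parts.card - 1).factorial : ℝ)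

open Classical in
theorem sum_cumulantCoeff_sameTraces {A : Set ι} (hA : A.Nonempty) (hA' : Aᶜ.Nonempty)
    (τ : Finpartition (Finset.univ : Finset ι)) :
    ∑ π with sameTraces A π τ, cumulantCoeff π = 0 := by
  set k := Nat.card (Quotient (Setoid.ker fun x : {x // x ∈ A} => τ.part x)) with hk
  set l := Nat.card (Quotient (Setoid.ker fun x : {x // x ∉ A} => τ.part x)) with hl
  have hk0 : k ≠ 0 := by
    obtain ⟨a, ha⟩ := hA
    have : Nonempty (Quotient (Setoid.ker fun x : {x // x ∈ A} => τ.part x)) :=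
      ⟨Quotient.mk _ ⟨a, ha⟩⟩
    exact Nat.card_ne_zero.2 ⟨this, inferInstance⟩
  have hl0 : l ≠ 0 := by
    obtain ⟨a, ha⟩ := hA'
    have : Nonempty (Quotient (Setoid.ker fun x : {x // x ∉ A} => τ.part x)) :=
      ⟨Quotient.mk _ ⟨a, ha⟩⟩
    exact Nat.card_ne_zero.2 ⟨this, inferInstance⟩
  have hpoly : ∑ π with sameTraces A π τ, descPochhammer ℝ π.parts.card =
      descPochhammer ℝ k * descPochhammer ℝ l := by
    refine Polynomial.eq_of_infinite_eval_eq _ _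
      ((Set.infinite_range_of_injective (Nat.cast_injective (R := ℝ))).mono ?_)
    rintro _ ⟨t, rfl⟩
    have := sum_descFactorial_sameTraces A τ t
    simp only [Set.mem_ofPred_eq, Polynomial.eval_finsetSum, Polynomial.eval_mul,
      descPochhammer_eval_eq_descFactorial]
    exact_mod_cast this
  -- The linear coefficient of a product needs a nonzero constant term in one factor; both constant
  -- terms vanish since `k, l ≠ 0`.
  have hcoeff := congrArg (fun p : Polynomial ℝ => p.coeff 1) hpoly
  simp only [Polynomial.finsetSum_coeff, Polynomial.mul_coeff_one,
    Polynomial.coeff_zero_eq_eval_zero, descPochhammer_eval_zero, hk0, hl0] at hcoeff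
  simp only [if_false, zero_mul, mul_zero, add_zero] at hcoeff
  rw [← hcoeff]
  refine Finset.sum_congr rfl fun π _ => (coeff_one_descPochhammer _ ?_).symm
  obtain ⟨a, -⟩ := hA
  exact Finset.card_ne_zero.2 ⟨_, π.part_mem.2 (Finset.mem_univ a)⟩

/-- If the value of `G` at a partition depends only on its traces on a proper nonempty subset and
on the complement, then the cumulant formed from `G` vanishes. -/
theorem sum_cumulantCoeff_smul_eq_zero {V : Type*} [AddCommGroup V] [Module ℝ V] {A : Set ι}
    (hA : A.Nonempty) (hA' : Aᶜ.Nonempty) (G : Finpartition (Finset.univ : Finset ι) → V)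
    (hG : ∀ π π', sameTraces A π π' → G π = G π') :
    ∑ π, cumulantCoeff π • G π = 0 := by
  classical
  refine Finset.sum_cancels_of_partition_cancels (sameTraces A) fun τ _ => ?_
  rw [← zero_smul ℝ (G τ), ← sum_cumulantCoeff_sameTraces hA hA' τ, Finset.sum_smul]
  refine Finset.sum_congr rfl fun π hπ => ?_
  rw [hG π τ (Finset.mem_filter.1 hπ).2]

end Combinatorics

/-! ### Partition measures on rectangles and under independence -/

section PartitionMeasure

universe w

variable {ι : Type} [Fintype ι] [DecidableEq ι] {Y : ι → Type w} [∀ a, MeasurableSpace (Y a)]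

theorem measurable_reassemble (π : Finpartition (Finset.univ : Finset ι)) :
    Measurable (fun (z : ∀ b : π.parts, ∀ a : b.1, Y a) (a : ι) =>
      z ⟨π.part a, π.part_mem.2 (Finset.mem_univ a)⟩ ⟨a, π.mem_part (Finset.mem_univ a)⟩) :=
  measurable_pi_lambda _ fun _ => (measurable_pi_apply _).comp (measurable_pi_apply _)

instance isProbabilityMeasure_map_restrict (μ : Measure (∀ a, Y a)) [IsProbabilityMeasure μ]
    (b : Finset ι) : IsProbabilityMeasure (μ.map (Finset.restrict (π := Y) b)) :=
  Measure.isProbabilityMeasure_map (Finset.measurable_restrict b).aemeasurable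

instance isProbabilityMeasure_partitionMeasure (μ : Measure (∀ a, Y a)) [IsProbabilityMeasure μ]
    (π : Finpartition (Finset.univ : Finset ι)) : IsProbabilityMeasure (partitionMeasure μ π) :=
  Measure.isProbabilityMeasure_map (measurable_reassemble π).aemeasurable

theorem partitionMeasure_pi (μ : Measure (∀ a, Y a)) [IsProbabilityMeasure μ]
    (π : Finpartition (Finset.univ : Finset ι)) {E : ∀ a, Set (Y a)}
    (hE : ∀ a, MeasurableSet (E a)) :
    partitionMeasure μ π (Set.univ.pi E) = ∏ b ∈ π.parts, μ {y | ∀ a ∈ b, y a ∈ E a} := by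
  rw [partitionMeasure, Measure.map_apply (measurable_reassemble π) (.univ_pi hE)]
  have hpre : (fun (z : ∀ b : π.parts, ∀ a : b.1, Y a) (a : ι) =>
      z ⟨π.part a, π.part_mem.2 (Finset.mem_univ a)⟩ ⟨a, π.mem_part (Finset.mem_univ a)⟩) ⁻¹'
        Set.univ.pi E = Set.univ.pi fun b : π.parts => Set.univ.pi fun a : b.1 => E a := by
    ext z
    simp only [Set.mem_preimage, Set.mem_univ_pi]
    constructor
    · rintro H ⟨b, hb⟩ ⟨a, ha⟩
      obtain rfl := π.part_eq_of_mem hb ha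
      exact H a
    · intro H a
      exact H ⟨π.part a, π.part_mem.2 (Finset.mem_univ a)⟩ ⟨a, π.mem_part (Finset.mem_univ a)⟩
  rw [hpre, Measure.pi_pi, ← Finset.prod_coe_sort π.parts]
  refine Finset.prod_congr rfl fun b _ => ?_
  rw [Measure.map_apply (Finset.measurable_restrict b.1) (.univ_pi fun a => hE a)]
  congr 1
  ext y
  simp

theorem integral_partitionMeasure_prod (μ : Measure (∀ a, Y a)) [IsProbabilityMeasure μ]
    (π : Finpartition (Finset.univ : Finset ι)) {g : ∀ a, Y a → ℝ}
    (hg : ∀ a, Measurable (g a)) :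
    ∫ y, ∏ a, g a (y a) ∂(partitionMeasure μ π) =
      ∏ b ∈ π.parts, ∫ y, ∏ a ∈ b, g a (y a) ∂μ := by
  have hmeas : Measurable fun y : ∀ a, Y a => ∏ a, g a (y a) :=
    Finset.measurable_prod _ fun a _ => (hg a).comp (measurable_pi_apply a)
  have hregroup : ∀ z : ∀ b : π.parts, ∀ a : b.1, Y a,
      ∏ a, g a (z ⟨π.part a, π.part_mem.2 (Finset.mem_univ a)⟩
        ⟨a, π.mem_part (Finset.mem_univ a)⟩) = ∏ b : π.parts, ∏ a : b.1, g a (z b a) := by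
    intro z
    rw [← Fintype.prod_sigma' (fun (b : π.parts) (a : b.1) => g a (z b a))]
    -- Pairs of a block and one of its elements correspond bijectively to the elements of `ι`.
    refine (Fintype.prod_bijective (fun p : Σ b : π.parts, b.1 => (p.2.1 : ι)) ⟨?_, ?_⟩ _ _ ?_).symm
    · rintro ⟨⟨b, hb⟩, ⟨a, ha⟩⟩ ⟨⟨b', hb'⟩, ⟨a', ha'⟩⟩ (rfl : a = a')
      obtain rfl := π.eq_of_mem_parts hb hb' ha ha'
      rfl
    · intro a
      exact ⟨⟨⟨π.part a, π.part_mem.2 (Finset.mem_univ a)⟩,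
        ⟨a, π.mem_part (Finset.mem_univ a)⟩⟩, rfl⟩
    · rintro ⟨⟨b, hb⟩, ⟨a, ha⟩⟩
      obtain rfl := π.part_eq_of_mem hb ha
      rfl
  rw [partitionMeasure, integral_map (measurable_reassemble π).aemeasurable
    hmeas.aestronglyMeasurable]
  simp_rw [hregroup]
  rw [integral_fintype_prod_eq_prod (fun (b : π.parts) (z : ∀ a : b.1, Y a) => ∏ a : b.1, g a (z a)),
    ← Finset.prod_coe_sort π.parts]
  refine Finset.prod_congr rfl fun b _ => ?_
  rw [integral_map (Finset.measurable_restrict b.1).aemeasurable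
    (f := fun z : ∀ a : b.1, Y a => ∏ a : b.1, g a (z a))
    (Finset.measurable_prod _ fun (a : b.1) _ =>
      (hg a).comp (measurable_pi_apply a)).aestronglyMeasurable]
  refine integral_congr_ae (.of_forall fun y => ?_)
  exact Finset.prod_coe_sort b.1 fun a => g a (y a)

open Classical in
-- Blocks missing `A` contribute `m ∅ = 1`, and distinct blocks meeting `A` have distinct traces.
-- The product thus runs over the set of nonempty traces, up to trivial factors, and this set
-- depends only on the relation restricted to `A`.
theorem prod_parts_filter_congr {M : Type*} [CommMonoid M] {m : Finset ι → M} (hm : m ∅ = 1)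
    (A : Set ι) {π π' : Finpartition (Finset.univ : Finset ι)}
    (h : ∀ x ∈ A, ∀ y ∈ A, π.part x = π.part y ↔ π'.part x = π'.part y) :
    ∏ b ∈ π.parts, m (b.filter (· ∈ A)) = ∏ b ∈ π'.parts, m (b.filter (· ∈ A)) := by
  have key : ∀ π : Finpartition (Finset.univ : Finset ι),
      ∏ b ∈ π.parts, m (b.filter (· ∈ A)) =
        ∏ c ∈ (Finset.univ.filter (· ∈ A)).image (fun x => (π.part x).filter (· ∈ A)), m c := by
    intro π
    have hne : ∀ b : Finset ι, m (b.filter (· ∈ A)) ≠ 1 → ∃ x ∈ b, x ∈ A := by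
      intro b hb
      by_contra! H
      rw [Finset.filter_false_of_mem H] at hb
      exact hb hm
    refine Finset.prod_bij_ne_one (fun (b : Finset ι) _ _ => b.filter (· ∈ A)) ?_ ?_ ?_ (fun _ _ _ => rfl)
    · intro b hb hb'
      obtain ⟨x, hx, hxA⟩ := hne b hb'
      refine Finset.mem_image.2 ⟨x, by simpa using hxA, ?_⟩
      rw [π.part_eq_of_mem hb hx]
    · intro b hb hb' c hc hc' hbc
      obtain ⟨x, hx, hxA⟩ := hne b hb'
      have hxc : x ∈ c.filter (· ∈ A) := hbc ▸ Finset.mem_filter.2 ⟨hx, hxA⟩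
      exact π.eq_of_mem_parts hb hc hx (Finset.mem_filter.1 hxc).1
    · intro c hc hc'
      obtain ⟨x, -, rfl⟩ := Finset.mem_image.1 hc
      exact ⟨_, π.part_mem.2 (Finset.mem_univ x), hc', rfl⟩
  rw [key, key]
  congr 1
  refine Finset.image_congr fun x hx => ?_
  have hxA : x ∈ A := by simpa using hx
  ext y
  simp only [Finset.mem_filter]
  refine and_congr_left fun hy => ?_
  rw [π.mem_part_iff_part_eq_part (Finset.mem_univ _) (Finset.mem_univ _),
    π'.mem_part_iff_part_eq_part (Finset.mem_univ _) (Finset.mem_univ _), h y hy x hxA]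

/-- If the coordinates in `A` are independent of those outside `A`, then the partition measures
depend only on the traces of the partition on `A` and on its complement. -/
theorem partitionMeasure_eq_of_sameTraces (μ : Measure (∀ a, Y a)) [IsProbabilityMeasure μ]
    (A : Set ι)
    (hμ : ∀ E : ∀ a, Set (Y a), (∀ a, MeasurableSet (E a)) → ∀ b : Finset ι,
      μ {y | ∀ a ∈ b, y a ∈ E a} =
        μ {y | ∀ a ∈ b, a ∈ A → y a ∈ E a} * μ {y | ∀ a ∈ b, a ∉ A → y a ∈ E a})
    {π π' : Finpartition (Finset.univ : Finset ι)} (h : sameTraces A π π') :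
    partitionMeasure μ π = partitionMeasure μ π' := by
  classical
  -- Measurable rectangles form a generating π-system; on them each block factor splits by `hμ` into
  -- an `A` part and an `Aᶜ` part.
  refine ext_of_generate_finite _ generateFrom_pi.symm isPiSystem_pi ?_ (by simp)
  rintro _ ⟨E, hE, rfl⟩
  replace hE : ∀ a, MeasurableSet (E a) := fun a => hE a (Set.mem_univ a)
  rw [partitionMeasure_pi μ π hE, partitionMeasure_pi μ π' hE]
  simp only [hμ E hE, Finset.prod_mul_distrib]
  set m : Finset ι → ENNReal := fun b => μ {y | ∀ a ∈ b, y a ∈ E a} with hm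
  have h1 : ∀ b : Finset ι, μ {y | ∀ a ∈ b, a ∈ A → y a ∈ E a} = m (b.filter (· ∈ A)) := by
    intro b
    simp only [hm, Finset.mem_filter, and_imp]
  have h2 : ∀ b : Finset ι, μ {y | ∀ a ∈ b, a ∉ A → y a ∈ E a} = m (b.filter (· ∈ Aᶜ)) := by
    intro b
    simp only [hm, Finset.mem_filter, and_imp, Set.mem_compl_iff]
  have hm1 : m ∅ = 1 := by simp [hm]
  simp only [h1, h2]
  refine congrArg₂ (· * ·) (prod_parts_filter_congr hm1 A fun x hx y hy =>
    h x y (by simp [hx, hy])) ?_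
  convert prod_parts_filter_congr hm1 Aᶜ fun x hx y hy => h x y
      (by simp [Set.mem_compl_iff _ _ |>.1 hx, Set.mem_compl_iff _ _ |>.1 hy])

end PartitionMeasure

/-! ### Diagonal measures of product measures -/

section Diagonal

variable {d : ℕ} {X : Fin d → Type u} [∀ j, MeasurableSpace (X j)]

theorem measurable_diagonal (i : Fin d → ℕ) :
    Measurable fun (x : ∀ j, X j) (s : Slot i) => x s.1 :=
  measurable_pi_lambda _ fun s => measurable_pi_apply s.1

instance isProbabilityMeasure_diagonalMeasure (γ : Measure (∀ j, X j)) [IsProbabilityMeasure γ]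
    (i : Fin d → ℕ) : IsProbabilityMeasure (diagonalMeasure γ i) :=
  Measure.isProbabilityMeasure_map (measurable_diagonal i).aemeasurable

theorem diagonalMeasure_pi_indep (ν : ∀ j, Measure (X j)) [∀ j, IsProbabilityMeasure (ν j)]
    (i : Fin d → ℕ) (j₀ : Fin d) {E : ∀ s : Slot i, Set (X s.1)}
    (hE : ∀ s, MeasurableSet (E s)) (b : Finset (Slot i)) :
    diagonalMeasure (Measure.pi ν) i {y | ∀ s ∈ b, y s ∈ E s} =
      diagonalMeasure (Measure.pi ν) i {y | ∀ s ∈ b, s.1 = j₀ → y s ∈ E s} *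
      diagonalMeasure (Measure.pi ν) i {y | ∀ s ∈ b, ¬ s.1 = j₀ → y s ∈ E s} := by
  -- The diagonal pulls a rectangle back to a rectangle whose `j`-th side is an intersection over
  -- the copies of `j`. The predicate `P` covers all three events at once.
  have key : ∀ P : Slot i → Prop, diagonalMeasure (Measure.pi ν) i {y | ∀ s, P s → y s ∈ E s} =
      ∏ j, ν j {x | ∀ r, P ⟨j, r⟩ → x ∈ E ⟨j, r⟩} := by
    intro P
    have hmeas : MeasurableSet {y : ∀ s : Slot i, X s.1 | ∀ s, P s → y s ∈ E s} := by
      simp only [Set.ofPred_forall]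
      exact .iInter fun s => .iInter fun _ => measurable_pi_apply s (hE s)
    rw [diagonalMeasure, Measure.map_apply (measurable_diagonal i) hmeas, ← Measure.pi_pi]
    congr 1
    ext x
    simp only [Set.mem_preimage, Set.mem_ofPred_eq, Set.mem_univ_pi]
    exact ⟨fun H j r => H ⟨j, r⟩, fun H s => H s.1 s.2⟩
  have key2 := key fun s => s ∈ b ∧ s.1 = j₀
  have key3 := key fun s => s ∈ b ∧ ¬ s.1 = j₀
  simp only [and_imp] at key2 key3
  rw [key, key2, key3, ← Finset.prod_mul_distrib]
  refine Finset.prod_congr rfl fun j _ => ?_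
  by_cases hj : j = j₀ <;> simp [hj]

end Diagonal

/-! ### Reduction to scalar cumulants -/

section Functional

variable {d : ℕ} {X : Fin d → Type u} {B : Fin d → Type v}
  [∀ j, NormedAddCommGroup (B j)] [∀ j, NormedSpace ℝ (B j)]

/-- The continuous linear functional `⨂ f_s` on `B^{⊗ i}`. -/
noncomputable def tensorFunctional (i : Fin d → ℕ) (f : ∀ s : Slot i, StrongDual ℝ (B s.1)) :
    TensorPower B i →L[ℝ] ℝ :=
  (PiTensorProduct.liftIsometry ℝ (fun s : Slot i => B s.1) ℝ
    ((ContinuousMultilinearMap.mkPiAlgebra ℝ (Slot i) ℝ).compContinuousLinearMap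
      f)).fromCompletion

theorem tensorFunctional_featureTensor (φ : ∀ j, X j → B j) (i : Fin d → ℕ)
    (f : ∀ s : Slot i, StrongDual ℝ (B s.1)) (y : ∀ s : Slot i, X s.1) :
    tensorFunctional i f (featureTensor φ i y) = ∏ s, f s (φ s.1 (y s)) := by
  rw [tensorFunctional, featureTensor, ContinuousLinearMap.fromCompletion_apply_coe,
    PiTensorProduct.liftIsometry_apply_apply, PiTensorProduct.lift.tprod]
  simp

theorem continuous_featureTensor [∀ j, TopologicalSpace (X j)] {φ : ∀ j, X j → B j} (hcont : ∀ j, Continuous (φ j))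
    (i : Fin d → ℕ) : Continuous (featureTensor φ i) := by
  have h : Continuous fun y : ∀ s : Slot i, X s.1 =>
      PiTensorProduct.tprodL ℝ (E := fun s : Slot i => B s.1) fun s => φ s.1 (y s) :=
    (PiTensorProduct.tprodL ℝ).cont.comp
      (continuous_pi fun s => (hcont s.1).comp (continuous_apply s))
  exact (UniformSpace.Completion.continuous_coe _).comp h

theorem norm_featureTensor_le (φ : ∀ j, X j → B j) (i : Fin d → ℕ) (y : ∀ s : Slot i, X s.1) :
    ‖featureTensor φ i y‖ ≤ ∏ s, ‖φ s.1 (y s)‖ := by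
  rw [featureTensor, UniformSpace.Completion.norm_coe]
  exact PiTensorProduct.projectiveSeminorm_tprod_le _

theorem exists_norm_featureTensor_le {φ : ∀ j, X j → B j}
    (hbdd : ∀ j, ∃ C : ℝ, ∀ x, ‖φ j x‖ ≤ C) (i : Fin d → ℕ) :
    ∃ C : ℝ, ∀ y, ‖featureTensor φ i y‖ ≤ C := by
  choose C hC using hbdd
  exact ⟨∏ s : Slot i, C s.1, fun y => (norm_featureTensor_le φ i y).trans
    (Finset.prod_le_prod (fun _ _ => norm_nonneg _) fun s _ => hC s.1 (y s))⟩

variable [∀ j, TopologicalSpace (X j)] [∀ j, PolishSpace (X j)] [∀ j, MeasurableSpace (X j)]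
  [∀ j, BorelSpace (X j)]

theorem integrable_featureTensor {φ : ∀ j, X j → B j} (hcont : ∀ j, Continuous (φ j))
    (hbdd : ∀ j, ∃ C : ℝ, ∀ x, ‖φ j x‖ ≤ C) (i : Fin d → ℕ)
    (μ : Measure (∀ s : Slot i, X s.1)) [IsFiniteMeasure μ] :
    Integrable (featureTensor φ i) μ := by
  obtain ⟨C, hC⟩ := exists_norm_featureTensor_le hbdd i
  exact .of_bound (continuous_featureTensor hcont i).aestronglyMeasurable C (.of_forall hC)

/-- A continuous functional commutes with the Bochner integral, and the integral of a product
function against a partition measure factors over the blocks. -/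
theorem tensorFunctional_cumulant {φ : ∀ j, X j → B j} (hcont : ∀ j, Continuous (φ j))
    (hbdd : ∀ j, ∃ C : ℝ, ∀ x, ‖φ j x‖ ≤ C) (γ : Measure (∀ j, X j)) [IsProbabilityMeasure γ]
    (i : Fin d → ℕ) (f : ∀ s : Slot i, StrongDual ℝ (B s.1)) :
    tensorFunctional i f (cumulant φ γ i) =
      ∑ π : Finpartition (Finset.univ : Finset (Slot i)), cumulantCoeff π *
        ∏ b ∈ π.parts, ∫ x, ∏ s ∈ b, f s (φ s.1 (x s.1)) ∂γ := by
  have hg : ∀ s : Slot i, Continuous fun x : X s.1 => f s (φ s.1 x) := fun s =>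
    (f s).continuous.comp (hcont s.1)
  rw [cumulant, map_sum]
  refine Finset.sum_congr rfl fun π _ => ?_
  rw [map_smul, smul_eq_mul, cumulantCoeff,
    ← (tensorFunctional i f).integral_comp_comm (integrable_featureTensor hcont hbdd i _)]
  simp_rw [tensorFunctional_featureTensor]
  rw [integral_partitionMeasure_prod _ π fun s => (hg s).measurable]
  congr 1
  refine Finset.prod_congr rfl fun b _ => ?_
  rw [diagonalMeasure, integral_map (measurable_diagonal i).aemeasurable]
  refine (Continuous.measurable ?_).aestronglyMeasurable
  exact continuous_finsetProd _ fun s _ => (hg s).comp (continuous_apply s)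

end Functional

/-! ### Cumulants determine moments, and moments determine the measure -/

section Moments

variable {d : ℕ} {X : Fin d → Type u} {B : Fin d → Type v}
  [∀ j, NormedAddCommGroup (B j)] [∀ j, NormedSpace ℝ (B j)]

/-- A product over a block of slots is a product over all slots of a smaller multi-index. -/
theorem exists_slot_prod_eq (φ : ∀ j, X j → B j) {i : Fin d → ℕ}
    (f : ∀ s : Slot i, StrongDual ℝ (B s.1)) (b : Finset (Slot i)) :
    ∃ (i' : Fin d → ℕ) (f' : ∀ s : Slot i', StrongDual ℝ (B s.1)),
      Fintype.card (Slot i') = b.card ∧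
      ∀ x : ∀ j, X j, ∏ s ∈ b, f s (φ s.1 (x s.1)) = ∏ s, f' s (φ s.1 (x s.1)) := by
  -- `T j` collects the copies of `j` chosen by `b`; the smaller multi-index counts them.
  let T : ∀ j, Finset (Fin (i j)) := fun j => Finset.univ.filter fun r => (⟨j, r⟩ : Slot i) ∈ b
  have hb : b = Finset.univ.sigma T := by
    ext s
    simp [T]
  refine ⟨fun j => (T j).card, fun s => f ⟨s.1, ((T s.1).equivFin.symm s.2).1⟩, ?_, fun x => ?_⟩
  · rw [Fintype.card_sigma, hb, Finset.card_sigma]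
    simp
  · rw [hb, Finset.prod_sigma, Fintype.prod_sigma]
    refine Finset.prod_congr rfl fun j _ => ?_
    rw [← Finset.prod_coe_sort]
    exact (Equiv.prod_comp (T j).equivFin.symm
      fun r : T j => f ⟨j, r.1⟩ (φ j (x j))).symm

theorem parts_eq_singleton_of_univ_mem {ι : Type*} [Fintype ι] [DecidableEq ι]
    {π : Finpartition (Finset.univ : Finset ι)} (h : Finset.univ ∈ π.parts) :
    π.parts = {Finset.univ} := by
  refine Finset.eq_singleton_iff_unique_mem.2 ⟨h, fun b hb => ?_⟩
  obtain ⟨x, hx⟩ := π.nonempty_of_mem_parts hb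
  exact π.eq_of_mem_parts hb h hx (Finset.mem_univ x)

variable [∀ j, TopologicalSpace (X j)]

open BoundedContinuousFunction in
/-- The products of bounded continuous functions of the form `x ↦ f (φ j (x j))`. -/
def monomials (φ : ∀ j, X j → B j) : Submonoid ((∀ j, X j) →ᵇ ℝ) where
  carrier := {p | ∃ (i : Fin d → ℕ) (f : ∀ s : Slot i, StrongDual ℝ (B s.1)),
    ∀ x, p x = ∏ s, f s (φ s.1 (x s.1))}
  one_mem' := ⟨0, fun s => s.2.elim0, fun x => by
    rw [Fintype.prod_sigma]
    simp⟩
  mul_mem' := by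
    rintro p q ⟨i, f, hf⟩ ⟨i', f', hf'⟩
    refine ⟨i + i', fun s => Fin.append (fun r => f ⟨s.1, r⟩) (fun r => f' ⟨s.1, r⟩) s.2,
      fun x => ?_⟩
    rw [BoundedContinuousFunction.mul_apply, hf, hf', Fintype.prod_sigma, Fintype.prod_sigma,
      Fintype.prod_sigma, ← Finset.prod_mul_distrib]
    refine Finset.prod_congr rfl fun j _ => ?_
    exact ((Fin.prod_univ_add (a := i j) (b := i' j) _).trans (by simp)).symm

theorem mem_monomials_of_coordinate (φ : ∀ j, X j → B j) (j : Fin d) (l : StrongDual ℝ (B j))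
    (p : BoundedContinuousFunction (∀ j, X j) ℝ) (hp : ∀ x, p x = l (φ j (x j))) :
    p ∈ monomials φ := by
  refine ⟨Pi.single j 1, fun s => Pi.single (M := fun k => StrongDual ℝ (B k)) j l s.1,
    fun x => ?_⟩
  rw [Fintype.prod_sigma, Fintype.prod_eq_single j, hp]
  · have hconst : ∀ (n : ℕ) (c : ℝ), n = 1 → c = ∏ _r : Fin n, c := by
      rintro _ c rfl
      simp
    refine (hconst _ _ (Pi.single_eq_same j 1)).trans (Finset.prod_congr rfl fun r _ => ?_)
    simp
  · intro k hk
    have : IsEmpty (Fin ((Pi.single j 1 : Fin d → ℕ) k)) := by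
      rw [Pi.single_eq_of_ne hk]
      infer_instance
    exact Fintype.prod_empty _

variable [∀ j, PolishSpace (X j)] [∀ j, MeasurableSpace (X j)] [∀ j, BorelSpace (X j)]

theorem moments_eq_of_cumulants_eq {φ : ∀ j, X j → B j} (hcont : ∀ j, Continuous (φ j))
    (hbdd : ∀ j, ∃ C : ℝ, ∀ x, ‖φ j x‖ ≤ C) {γ η : Measure (∀ j, X j)}
    [IsProbabilityMeasure γ] [IsProbabilityMeasure η] (h : cumulants φ γ = cumulants φ η)
    (i : Fin d → ℕ) (f : ∀ s : Slot i, StrongDual ℝ (B s.1)) :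
    ∫ x, ∏ s, f s (φ s.1 (x s.1)) ∂γ = ∫ x, ∏ s, f s (φ s.1 (x s.1)) ∂η := by
  induction hn : Fintype.card (Slot i) using Nat.strong_induction_on generalizing i with
  | _ n ih =>
  subst hn
  by_cases hne : (Finset.univ : Finset (Slot i)) = ∅
  · simp [hne]
  -- A proper block has fewer slots, so its moment falls under the induction hypothesis.
  have hblock : ∀ b : Finset (Slot i), b ≠ Finset.univ →
      ∫ x, ∏ s ∈ b, f s (φ s.1 (x s.1)) ∂γ = ∫ x, ∏ s ∈ b, f s (φ s.1 (x s.1)) ∂η := by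
    intro b hb
    obtain ⟨i', f', hcard, hprod⟩ := exists_slot_prod_eq φ f b
    simp_rw [hprod]
    exact ih _ (by rw [hcard]; exact (Finset.card_lt_iff_ne_univ b).2 hb) i' f' rfl
  have hκ := congrArg (tensorFunctional i f) (congrFun h i)
  simp only [cumulants, tensorFunctional_cumulant hcont hbdd] at hκ
  -- The one-block partition isolates the moment of full degree, with coefficient 1.
  let π₀ : Finpartition (Finset.univ : Finset (Slot i)) := Finpartition.indiscrete hne
  have hπ₀ : π₀.parts = {Finset.univ} := rfl
  rw [← Finset.add_sum_erase _ _ (Finset.mem_univ π₀),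
    ← Finset.add_sum_erase _ _ (Finset.mem_univ π₀)] at hκ
  have hrest : ∑ π ∈ Finset.univ.erase π₀, cumulantCoeff π *
        ∏ b ∈ π.parts, ∫ x, ∏ s ∈ b, f s (φ s.1 (x s.1)) ∂γ =
      ∑ π ∈ Finset.univ.erase π₀, cumulantCoeff π *
        ∏ b ∈ π.parts, ∫ x, ∏ s ∈ b, f s (φ s.1 (x s.1)) ∂η := by
    refine Finset.sum_congr rfl fun π hπ => ?_
    congr 1
    refine Finset.prod_congr rfl fun b hb => hblock b ?_
    rintro rfl
    exact (Finset.mem_erase.1 hπ).1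
      (Finpartition.ext ((parts_eq_singleton_of_univ_mem hb).trans hπ₀.symm))
  rw [hrest, add_left_inj] at hκ
  simpa [hπ₀, cumulantCoeff] using hκ

theorem eq_of_moments_eq {φ : ∀ j, X j → B j} (hcont : ∀ j, Continuous (φ j))
    (hbdd : ∀ j, ∃ C : ℝ, ∀ x, ‖φ j x‖ ≤ C) (hinj : ∀ j, Function.Injective (φ j))
    {γ η : Measure (∀ j, X j)} [IsProbabilityMeasure γ] [IsProbabilityMeasure η]
    (h : ∀ (i : Fin d → ℕ) (f : ∀ s : Slot i, StrongDual ℝ (B s.1)),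
      ∫ x, ∏ s, f s (φ s.1 (x s.1)) ∂γ = ∫ x, ∏ s, f s (φ s.1 (x s.1)) ∂η) :
    γ = η := by
  let S := Algebra.adjoin ℝ (monomials φ : Set (BoundedContinuousFunction (∀ j, X j) ℝ))
  have hstar : ∀ p : BoundedContinuousFunction (∀ j, X j) ℝ, star p = p := by
    intro p
    ext x
    simp
  let A : StarSubalgebra ℝ (BoundedContinuousFunction (∀ j, X j) ℝ) :=
    { S with star_mem' := fun {p} hp => (hstar p).symm ▸ hp }
  refine ext_of_forall_mem_subalgebra_integral_eq_of_polish (𝕜 := ℝ) (A := A) ?_ ?_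
  · intro x y hxy
    obtain ⟨j, hj⟩ := Function.ne_iff.1 hxy
    -- Hahn–Banach separates the two distinct values of the injective `φ j`.
    obtain ⟨l, hl⟩ := SeparatingDual.exists_separating_of_ne (R := ℝ) ((hinj j).ne hj)
    obtain ⟨C, hC⟩ := hbdd j
    let p : BoundedContinuousFunction (∀ j, X j) ℝ :=
      BoundedContinuousFunction.ofNormedAddCommGroup (fun x => l (φ j (x j)))
        (l.continuous.comp ((hcont j).comp (continuous_apply j))) (‖l‖ * C)
        fun x => l.le_opNorm_of_le (hC (x j))
    have hp : p ∈ A := Algebra.subset_adjoin (mem_monomials_of_coordinate φ j l p fun _ => rfl)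
    exact ⟨p, ⟨_, ⟨p, hp, rfl⟩, rfl⟩, hl⟩
  · intro p hp
    -- Monomials are closed under products, so the algebra they generate is their linear span and
    -- linearity of the integral suffices.
    have hp' : p ∈ Submodule.span ℝ
        (monomials φ : Set (BoundedContinuousFunction (∀ j, X j) ℝ)) := by
      rw [← Submonoid.closure_eq (monomials φ), ← Algebra.adjoin_eq_span]
      exact hp
    clear hp
    induction hp' using Submodule.span_induction with
    | mem p hp =>
      obtain ⟨i, f, hf⟩ := hp
      simp_rw [hf]
      exact h i f
    | zero => simp
    | add p q _ _ ihp ihq =>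
      simp only [BoundedContinuousFunction.coe_add, Pi.add_apply]
      rw [integral_add (p.integrable γ) (q.integrable γ),
        integral_add (p.integrable η) (q.integrable η), ihp, ihq]
    | smul c p _ ihp =>
      simp only [BoundedContinuousFunction.coe_smul]
      rw [integral_smul, integral_smul, ihp]

end Moments

/-! ### Cross cumulants of products, and the other cumulants -/

section Independence

variable {d : ℕ} {X : Fin d → Type u} [∀ j, MeasurableSpace (X j)] {B : Fin d → Type v}
  [∀ j, NormedAddCommGroup (B j)] [∀ j, NormedSpace ℝ (B j)]

/-- The cross cumulants of a product measure vanish. -/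
theorem cumulant_pi_eq_zero_of_isCross (φ : ∀ j, X j → B j) (ν : ∀ j, Measure (X j))
    [∀ j, IsProbabilityMeasure (ν j)] {i : Fin d → ℕ} (hi : IsCross i) :
    cumulant φ (Measure.pi ν) i = 0 := by
  obtain ⟨j, k, hjk, hj, hk⟩ := hi
  refine sum_cumulantCoeff_smul_eq_zero (A := {s : Slot i | s.1 = j}) ⟨⟨j, ⟨0, hj⟩⟩, rfl⟩
    ⟨⟨k, ⟨0, hk⟩⟩, hjk.symm⟩
    (fun π => ∫ y, featureTensor φ i y ∂(partitionMeasure (diagonalMeasure (Measure.pi ν) i) π))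
    fun π π' h => ?_
  exact congrArg (fun μ => ∫ y, featureTensor φ i y ∂μ) (partitionMeasure_eq_of_sameTraces _ _
    (fun E hE b => diagonalMeasure_pi_indep ν i j hE b) h)

/-- The diagonal measures of a multi-index that is not cross depend only on the marginals. -/
theorem diagonalMeasure_eq_of_not_isCross {γ η : Measure (∀ j, X j)} [IsProbabilityMeasure γ]
    [IsProbabilityMeasure η] (h : ∀ j, γ.map (fun x => x j) = η.map (fun x => x j))
    {i : Fin d → ℕ} (hi : ¬ IsCross i) : diagonalMeasure γ i = diagonalMeasure η i := by
  rcases isEmpty_or_nonempty (Slot i) with hempty | ⟨⟨j, r⟩⟩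
  -- Without slots the space is a single point, which carries only one probability measure.
  · refine Measure.ext fun s _ => ?_
    rcases s.eq_empty_or_nonempty with rfl | hs
    · simp
    · rw [Subsingleton.eq_univ_of_nonempty hs]
      simp
  · have hall : ∀ s : Slot i, j = s.1 := by
      rintro ⟨k, q⟩
      by_contra hjk
      exact hi ⟨j, k, hjk, r.pos, q.pos⟩
    have hT : Measurable fun (x : X j) (s : Slot i) => (hall s ▸ x : X s.1) := by
      refine measurable_pi_lambda _ fun s => ?_
      have : ∀ (k : Fin d) (hk : j = k), Measurable fun x : X j => (hk ▸ x : X k) := by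
        rintro _ rfl
        exact measurable_id
      exact this _ (hall s)
    -- All slots are copies of `j`, so the diagonal map factors through the `j`-th coordinate.
    have hfac : (fun (x : ∀ j, X j) (s : Slot i) => x s.1) =
        (fun (x : X j) (s : Slot i) => (hall s ▸ x : X s.1)) ∘ fun x => x j := by
      funext x s
      have : ∀ (k : Fin d) (hk : j = k), x k = (hk ▸ x j : X k) := by
        rintro _ rfl
        rfl
      exact this _ (hall s)
    rw [diagonalMeasure, diagonalMeasure, hfac, ← Measure.map_map hT (measurable_pi_apply j),
      ← Measure.map_map hT (measurable_pi_apply j), h j]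

end Independence

end TensorCumulant

theorem mainTheorem3 {d : ℕ} {X : Fin d → Type*} [∀ j, TopologicalSpace (X j)]
    [∀ j, PolishSpace (X j)] [∀ j, MeasurableSpace (X j)] [∀ j, BorelSpace (X j)]
    {B : Fin d → Type*} [∀ j, NormedAddCommGroup (B j)] [∀ j, NormedSpace ℝ (B j)]
    [∀ j, CompleteSpace (B j)] [∀ j, TopologicalSpace.SeparableSpace (B j)]
    (φ : ∀ j, X j → B j) (hcont : ∀ j, Continuous (φ j))
    (hbdd : ∀ j, ∃ C : ℝ, ∀ x, ‖φ j x‖ ≤ C) (hinj : ∀ j, Function.Injective (φ j))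
    (γ η : Measure (∀ j, X j)) [IsProbabilityMeasure γ] [IsProbabilityMeasure η] :
    (γ = η ↔ TensorCumulant.cumulants φ γ = TensorCumulant.cumulants φ η) ∧
    (γ = Measure.pi (fun j => γ.map (fun x => x j)) ↔
      ∀ i : Fin d → ℕ, TensorCumulant.IsCross i → TensorCumulant.cumulant φ γ i = 0) := by
  -- The second measure stays general so that the product of the marginals of `γ` can be inserted
  -- later.
  have hpart1 : ∀ η : Measure (∀ j, X j), IsProbabilityMeasure η →
      TensorCumulant.cumulants φ γ = TensorCumulant.cumulants φ η → γ = η := fun η _ h =>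
    TensorCumulant.eq_of_moments_eq hcont hbdd hinj
      (TensorCumulant.moments_eq_of_cumulants_eq hcont hbdd h)
  refine ⟨⟨fun h => h ▸ rfl, hpart1 η inferInstance⟩, ?_⟩
  have hprob : ∀ j, IsProbabilityMeasure (γ.map fun x => x j) := fun j =>
    Measure.isProbabilityMeasure_map (measurable_pi_apply j).aemeasurable
  have hcross := fun i hi => TensorCumulant.cumulant_pi_eq_zero_of_isCross φ
    (fun j => γ.map fun x => x j) (i := i) hi
  constructor
  · intro h i hi
    rw [h]
    exact hcross i hi
  · intro h
    refine hpart1 _ inferInstance (funext fun i => ?_)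
    by_cases hi : TensorCumulant.IsCross i
    · exact (h i hi).trans (hcross i hi).symm
    · have hdiag := TensorCumulant.diagonalMeasure_eq_of_not_isCross (γ := γ)
        (η := Measure.pi fun j => γ.map fun x => x j)
        (fun j => (measurePreserving_eval
          (fun j => γ.map fun x => x j) j).map_eq.symm) hi
      simp only [TensorCumulant.cumulants, TensorCumulant.cumulant, hdiag]
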